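/- **Notation.** For a tensor $A\in\mathbb R^{n_1\times n_2\times n_3}$ write $A[x,y,z]=\sum_{i,j,k}A_{ijk}x_iy_jz_k$, and for a set $\Omega\subseteq[n_1]\times[n_2]\times[n_3]$ let $\mathcal P_\Omega(A)_{ijk}=A_{ijk}$ if $(i,j,k)\in\Omega$ and $0$ otherwise. Put $T_{\max}=\max_{i,j,k}|T_{ijk}|$. **Theorem (Initialization).** (i) There is a universal constant $C>0$ such that the following holds for every $n\ge 1$, every symmetric tensor $T\in\mathbb R^{n\times n\times n}$ and every $p=\alpha/n^{3/2}\in[0,1]$ with $\alpha\ge\log n$. Let $\Omega\subseteq[n]^3$ be random: each triple $(i,j,k)$ with $i\le j\le k$ is included independently with probability $p$, together with all its permutations. Then, with probability at least $1-n^{-5}$, $$\|\mathcal P_\Omega(T)-pT\|_2\;\le\; C\,T_{\max}\,n^{3/2}\,p\,\frac{(\log n)^2}{\sqrt\alpha},\qquad\text{where } \|A\|_2=\max_{\|u\|=1}A[u,u,u].$$ (For $n=1$ the probability bound is $0$ and the claim is empty.) (ii) For every $\kappa$ there is a constant $C>0$ depending only on $\kappa$ such that the following holds for all $n_1,n_2,n_3\ge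 1$ with $n_1\le\kappa n_2n_3$, $n_2\le\kappa n_1n_3$ and $n_3\le\kappa n_1n_2$ (for instance, with $n_a\le\kappa n_b$ for all $a,b$, or with $n_1=n_2=n_3$ and $\kappa=1$), every tensor $T\in\mathbb R^{n_1\times n_2\times n_3}$, not necessarily symmetric, and every $p\in[0,1]$ with $p\sqrt{n_1n_2n_3}\ge\log n$, where $n=\max\{n_1,n_2,n_3\}$. Let $\Omega\subseteq[n_1]\times[n_2]\times[n_3]$ contain each triple independently with probability $p$. Then, with probability at least $1-n^{-5}$, $$\max_{\|x\|=\|y\|=\|z\|=1}\big(\mathcal P_\Omega(T)-pT\big)[x,y,z]\;\le\; C\,T_{\max}\,(\log n)^2\,\sqrt{(n_1n_2n_3)^{1/2}\,p}\,.$$ -/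

import Mathlib

/-- Real third-order tensors of dimensions `n₁ × n₂ × n₃`. -/
abbrev Tensor3 (n₁ n₂ n₃ : ℕ) : Type := Fin n₁ → Fin n₂ → Fin n₃ → ℝ

/-- The index triples `[n₁] × [n₂] × [n₃]`. -/
abbrev Triple (n₁ n₂ n₃ : ℕ) : Type := Fin n₁ × Fin n₂ × Fin n₃

namespace Tensor3

/-- The trilinear form `A[x, y, z] = ∑ A i j k * x i * y j * z k`. -/
noncomputable def form {n₁ n₂ n₃ : ℕ} (A : Tensor3 n₁ n₂ n₃) (x : EuclideanSpace ℝ (Fin n₁))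
    (y : EuclideanSpace ℝ (Fin n₂)) (z : EuclideanSpace ℝ (Fin n₃)) : ℝ :=
  ∑ i, ∑ j, ∑ k, A i j k * x i * y j * z k

/-- The largest absolute value of an entry. -/
noncomputable def maxEntry {n₁ n₂ n₃ : ℕ} (A : Tensor3 n₁ n₂ n₃) : ℝ :=
  ⨆ t : Triple n₁ n₂ n₃, |A t.1 t.2.1 t.2.2|

open Classical in
/-- The projection `P_Ω` that keeps the entries in `Ω` and replaces the others by `0`. -/
noncomputable def proj {n₁ n₂ n₃ : ℕ} (Ω : Set (Triple n₁ n₂ n₃)) (A : Tensor3 n₁ n₂ n₃) :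
    Tensor3 n₁ n₂ n₃ :=
  fun i j k => if (i, j, k) ∈ Ω then A i j k else 0

/-- A tensor that is invariant under all permutations of its three indices (the two
transpositions below generate them). -/
def IsSymmetric {n : ℕ} (A : Tensor3 n n n) : Prop :=
  ∀ i j k, A i j k = A j i k ∧ A i j k = A i k j

/-- The operator norm `max_{‖u‖ = 1} A[u, u, u]` of a cubic tensor. -/
noncomputable def opNorm {n : ℕ} (A : Tensor3 n n n) : ℝ :=
  ⨆ u : Metric.sphere (0 : EuclideanSpace ℝ (Fin n)) 1, A.form u.1 u.1 u.1

/-- The trilinear operator norm `max_{‖x‖ = ‖y‖ = ‖z‖ = 1} A[x, y, z]`. -/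
noncomputable def triNorm {n₁ n₂ n₃ : ℕ} (A : Tensor3 n₁ n₂ n₃) : ℝ :=
  ⨆ w : Metric.sphere (0 : EuclideanSpace ℝ (Fin n₁)) 1 ×
      Metric.sphere (0 : EuclideanSpace ℝ (Fin n₂)) 1 ×
      Metric.sphere (0 : EuclideanSpace ℝ (Fin n₃)) 1, A.form w.1.1 w.2.1.1 w.2.2.1

end Tensor3

/-- The sorted triples `i ≤ j ≤ k`. -/
def sortedTriples (n : ℕ) : Set (Triple n n n) :=
  {t | t.1 ≤ t.2.1 ∧ t.2.1 ≤ t.2.2}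

/-- The set of all permutations of the triples in `B`. -/
def symmClosure {n : ℕ} (B : Set (Triple n n n)) : Set (Triple n n n) :=
  {t | (t.1, t.2.1, t.2.2) ∈ B ∨ (t.1, t.2.2, t.2.1) ∈ B ∨ (t.2.1, t.1, t.2.2) ∈ B ∨
    (t.2.1, t.2.2, t.1) ∈ B ∨ (t.2.2, t.1, t.2.1) ∈ B ∨ (t.2.2, t.2.1, t.1) ∈ B}

/-- The law of the symmetric random sample: each sorted triple is included independently with
probability `p`, together with all its permutations. -/
noncomputable def symmetricSample (n : ℕ) (p : unitInterval) :
    MeasureTheory.Measure (Set (Triple n n n)) :=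
  (ProbabilityTheory.setBernoulli (sortedTriples n) p).map symmClosure

/-- The law of the unconstrained random sample (a random tripartite `3`-uniform hypergraph): each
triple is included independently with probability `p`. -/
noncomputable def independentSample (n₁ n₂ n₃ : ℕ) (p : unitInterval) :
    MeasureTheory.Measure (Set (Triple n₁ n₂ n₃)) :=
  ProbabilityTheory.setBernoulli Set.univ p

/-!
The deviation tensor `P_Ω(T) - p T` is tested only on boxes `A × B × C` of indices, and the norm is
recovered from the boxes at the price of a power of `log n`.

*From boxes to unit vectors.* If a linear form is at most `M √|A|` on every indicator `1_A`, then
its `s`-th largest coefficient is `O(M / √s)`, so its Euclidean norm is `O(M √(log n))`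
(`sum_sq_le_harmonic`, `abs_sum_mul_le_of_indicator`). Releasing the three arguments of a trilinear
form one after the other costs `(log n) ^ (3 / 2)` (`abs_trilinear_le_of_boxes`).

*Boxes.* It remains to show that, with high probability, the entries of every box with sides
`a, b, c` sum to `O(√(√N p log n) √(abc))`, where `N = n₁ n₂ n₃`; the remaining factor `√(log n)` of
the theorem is spent here. Let `m` be the longest side. There are at most `n ^ (3m)` boxes with
these sides, and Bernstein's inequality (`setBernoulli_abs_tail`) with a union bound
handles every box for which its exponent exceeds a multiple of `m log n`. Otherwise the box is much
longer in one direction than the product of its two other sides (`box_trichotomy`), and then it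
suffices to count sampled entries: every line of length `d` contains at most `2 p d + 60 log n` of
them (`setBernoulli_degree_tail`), and `d ^ 2 ≤ κ N` makes this bound strong enough
(`abs_sum_box_le_of_degrees`).

*Both sampling models at once.* Everything is proved for `Ω = {t | q t ∈ ω}`, where `ω` is a
Bernoulli random set and `q` a map with fibres of size at most six (`form_deviation`). Independent
sampling is `q = id`; symmetric sampling is the map `sortTriple` that sorts the three indices.
-/

open MeasureTheory ProbabilityTheory

/-! ### Chernoff bound for weighted Bernoulli sums -/

lemma bernoulli_exp_le {p y : ℝ} (hp : 0 ≤ p) (hy : |y| ≤ 1) :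
    p * Real.exp y + (1 - p) ≤ Real.exp (p * y + p * y ^ 2) := by
  have h1 : Real.exp y ≤ 1 + y + y ^ 2 := by
    have := abs_le.1 (Real.abs_exp_sub_one_sub_id_le hy)
    linarith [this.2]
  calc p * Real.exp y + (1 - p) ≤ (p * y + p * y ^ 2) + 1 := by nlinarith
    _ ≤ _ := Real.add_one_le_exp _

open Classical in
/-- Indices outside `u` are never sampled, so their coefficients do not matter. -/
lemma integral_exp_sum_setBernoulli {ι : Type*} [Fintype ι] (u : Set ι) (p : unitInterval)
    (c : ι → ℝ) :
    ∫ ω, Real.exp (∑ s, c s * (if s ∈ ω then 1 else 0)) ∂(setBernoulli u p) =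
      ∏ s, (p * Real.exp (if s ∈ u then c s else 0) + (1 - p)) := by
  rw [setBernoulli_eq_map, Measure.infinitePi_eq_pi, integral_map]
  · simp only [Real.exp_sum, Set.mem_ofPred_eq]
    rw [integral_fintype_prod_eq_prod (fun s (P : Prop) => Real.exp (c s * if P then 1 else 0))]
    refine Finset.prod_congr rfl fun s _ => ?_
    rw [integral_add_measure (.of_finite) (.of_finite), integral_smul_nnreal_measure,
      integral_smul_nnreal_measure, integral_dirac, integral_dirac]
    by_cases h : s ∈ u <;> simp [h, NNReal.smul_def]
  · fun_prop
  · exact (measurable_of_finite _).aestronglyMeasurable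

open Classical in
/-- Chernoff bound for a weighted sum of centred Bernoulli variables in which each variable
`1[s ∈ ω]` appears at most six times. -/
lemma setBernoulli_tail {ι β : Type*} [Fintype ι] [Fintype β] {u : Set ι} (p : unitInterval)
    {q : β → ι} (hq : ∀ x, q x ∈ u) (hfib : ∀ s, (Finset.univ.filter fun x => q x = s).card ≤ 6)
    {w : β → ℝ} (hw : ∀ x, |w x| ≤ 1) (U : Finset β) {θ : ℝ} (h0 : 0 ≤ θ) (h6 : θ ≤ 1 / 6)
    (a : ℝ) :
    (setBernoulli u p).real {ω | a ≤ ∑ x ∈ U, w x * ((if q x ∈ ω then 1 else 0) - (p : ℝ))} ≤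
      Real.exp (-θ * a + 6 * p * θ ^ 2 * U.card) := by
  set c : ι → ℝ := fun s => ∑ x ∈ U with q x = s, w x with hc
  have hp0 : (0 : ℝ) ≤ p := p.2.1
  have hsplit : ∀ ω : Set ι, ∑ x ∈ U, w x * ((if q x ∈ ω then 1 else 0) - (p : ℝ)) =
      ∑ s, c s * (if s ∈ ω then 1 else 0) - p * ∑ s, c s := by
    intro ω
    rw [← Finset.sum_fiberwise U q (fun x => w x * ((if q x ∈ ω then 1 else 0) - (p : ℝ))),
      Finset.mul_sum, ← Finset.sum_sub_distrib]
    refine Finset.sum_congr rfl fun s _ => ?_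
    rw [hc]
    simp only
    rw [mul_comm (p : ℝ), ← mul_sub, Finset.sum_mul]
    refine Finset.sum_congr rfl fun x hx => ?_
    rw [(Finset.mem_filter.1 hx).2]
  -- grouping the terms by the value of `q` gives independent summands with coefficients `c s`, and
  -- `|c s| ≤ 6` is why `θ ≤ 1 / 6` keeps the exponents within reach of `bernoulli_exp_le`
  have hcard : ∀ s, ((U.filter fun x => q x = s).card : ℝ) ≤ 6 := by
    intro s
    exact_mod_cast (Finset.card_le_card (Finset.filter_subset_filter _ (Finset.subset_univ U))).trans
      (hfib s)
  have hc1 : ∀ s, |c s| ≤ (U.filter fun x => q x = s).card := by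
    intro s
    refine (Finset.abs_sum_le_sum_abs _ _).trans ?_
    refine (Finset.sum_le_sum fun x _ => hw x).trans ?_
    simp
  have hc6 : ∀ s, |c s| ≤ 6 := fun s => (hc1 s).trans (hcard s)
  have hc2 : ∑ s, c s ^ 2 ≤ 6 * U.card := by
    calc ∑ s, c s ^ 2 ≤ ∑ s, 6 * ((U.filter fun x => q x = s).card : ℝ) := by
          refine Finset.sum_le_sum fun s _ => ?_
          rw [← sq_abs, sq]
          exact mul_le_mul (hc6 s) (hc1 s) (abs_nonneg _) (by norm_num)
      _ = 6 * U.card := by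
          rw [← Finset.mul_sum, Finset.card_eq_sum_card_fiberwise (f := q) (t := Finset.univ)
            (by simp)]
          push_cast; rfl
  have hcu : ∀ s, s ∉ u → c s = 0 := by
    intro s hs
    rw [hc]
    refine Finset.sum_eq_zero fun x hx => absurd (hq x) ?_
    rwa [(Finset.mem_filter.1 hx).2]
  have hmgf : mgf (fun ω : Set ι => ∑ s, c s * (if s ∈ ω then 1 else 0)) (setBernoulli u p) θ ≤
      Real.exp (θ * (p * ∑ s, c s) + 6 * p * θ ^ 2 * U.card) := by
    rw [mgf]
    simp only [Finset.mul_sum, ← mul_assoc]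
    rw [integral_exp_sum_setBernoulli u p (fun s => θ * c s)]
    calc _ ≤ ∏ s, Real.exp (p * (θ * c s) + p * (θ * c s) ^ 2) := by
          refine Finset.prod_le_prod (fun s _ => ?_) fun s _ => ?_
          · have := p.2.2
            have := Real.exp_pos (if s ∈ u then θ * c s else 0)
            nlinarith [mul_nonneg hp0 this.le]
          · by_cases hs : s ∈ u
            · simp only [hs, if_true]
              refine bernoulli_exp_le hp0 ?_
              rw [abs_mul, abs_of_nonneg h0]
              nlinarith [hc6 s, abs_nonneg (c s)]
            · simp [hs, hcu s hs]
      _ = Real.exp (∑ s, (θ * p * c s + p * θ ^ 2 * c s ^ 2)) := by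
          rw [Real.exp_sum]
          refine Finset.prod_congr rfl fun s _ => ?_
          ring_nf
      _ ≤ _ := by
          rw [Real.exp_le_exp, Finset.sum_add_distrib, ← Finset.mul_sum _ _ (p * θ ^ 2 : ℝ)]
          have : 0 ≤ (p : ℝ) * θ ^ 2 := by positivity
          nlinarith
  have hset : {ω : Set ι | a ≤ ∑ x ∈ U, w x * ((if q x ∈ ω then 1 else 0) - (p : ℝ))} =
      {ω | a + p * ∑ s, c s ≤ ∑ s, c s * (if s ∈ ω then 1 else 0)} := by
    ext ω
    simp only [Set.mem_ofPred_eq, hsplit ω]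
    constructor <;> intro h <;> linarith
  rw [hset]
  refine (measure_ge_le_exp_mul_mgf _ h0 (.of_finite)).trans ?_
  refine (mul_le_mul_of_nonneg_left hmgf (Real.exp_pos _).le).trans ?_
  rw [← Real.exp_add]
  refine le_of_eq ?_
  congr 1
  ring

/-! ### Trilinear forms and boxes -/

/-- On a set of size `s` the smallest entry is at most `2 * M / √s` in absolute value; removing
entries one at a time, smallest first, gives a harmonic sum. -/
lemma sum_sq_le_harmonic {α : Type*} [DecidableEq α] {f : α → ℝ} {M : ℝ}
    (h : ∀ A : Finset α, |∑ i ∈ A, f i| ≤ M * √(A.card)) (S : Finset α) :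
    ∑ i ∈ S, f i ^ 2 ≤ 4 * M ^ 2 * (harmonic S.card : ℝ) := by
  induction hk : S.card generalizing S with
  | zero => simp [Finset.card_eq_zero.1 hk]
  | succ k ih =>
    have hne : S.Nonempty := Finset.card_pos.1 (by omega)
    obtain ⟨a, ha, hmin⟩ := S.exists_min_image (fun i => |f i|) hne
    have hM : 0 ≤ M := by
      have := (abs_nonneg _).trans (h {a})
      simpa using this
    have hsub : ∀ A ⊆ S, |∑ i ∈ A, f i| ≤ M * √(k + 1) := by
      intro A hA
      refine (h A).trans (mul_le_mul_of_nonneg_left (Real.sqrt_le_sqrt ?_) hM)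
      have := Finset.card_le_card hA
      rw [hk] at this
      exact_mod_cast this
    have habs : ∑ i ∈ S, |f i| ≤ 2 * (M * √(k + 1)) := by
      rw [← Finset.sum_filter_add_sum_filter_not S (fun i => 0 ≤ f i)]
      have h1 := abs_le.1 (hsub _ (S.filter_subset fun i => 0 ≤ f i))
      have h2 := abs_le.1 (hsub _ (S.filter_subset fun i => ¬ 0 ≤ f i))
      have e1 : ∑ i ∈ S with 0 ≤ f i, |f i| = ∑ i ∈ S with 0 ≤ f i, f i :=
        Finset.sum_congr rfl fun i hi => abs_of_nonneg (Finset.mem_filter.1 hi).2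
      have e2 : ∑ i ∈ S with ¬ 0 ≤ f i, |f i| = -∑ i ∈ S with ¬ 0 ≤ f i, f i := by
        rw [← Finset.sum_neg_distrib]
        exact Finset.sum_congr rfl fun i hi =>
          abs_of_neg (not_le.1 (Finset.mem_filter.1 hi).2)
      rw [e1, e2]
      linarith [h1.2, h2.1]
    have hk0 : (0 : ℝ) < k + 1 := by positivity
    have hmul : (k + 1) * |f a| ≤ 2 * (M * √(k + 1)) := by
      refine le_trans ?_ habs
      have := Finset.card_nsmul_le_sum S (fun i => |f i|) (|f a|) hmin
      rw [hk] at this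
      simpa using this
    have hsq : f a ^ 2 ≤ 4 * M ^ 2 * ((k : ℝ) + 1)⁻¹ := by
      have h2 := pow_le_pow_left₀ (by positivity) hmul 2
      rw [mul_pow, mul_pow, mul_pow, Real.sq_sqrt hk0.le, sq_abs] at h2
      rw [← div_eq_mul_inv, le_div_iff₀ hk0]
      nlinarith
    have := ih (S.erase a) (by rw [Finset.card_erase_of_mem ha, hk]; rfl)
    rw [← Finset.add_sum_erase _ _ ha, harmonic_succ]
    push_cast
    linarith

/-- A linear form that is bounded by `M` on all normalized indicators `1_A / √|A|` is bounded by
`M * √(4 * (1 + log n))` on the unit ball. -/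
lemma abs_sum_mul_le_of_indicator {m n : ℕ} (hmn : m ≤ n) {f : Fin m → ℝ} {M : ℝ}
    (h : ∀ A : Finset (Fin m), |∑ i ∈ A, f i| ≤ M * √(A.card)) (hM : 0 ≤ M) (x : Fin m → ℝ) :
    |∑ i, f i * x i| ≤ M * √(4 * (1 + Real.log n)) * √(∑ i, x i ^ 2) := by
  rcases Nat.eq_zero_or_pos m with rfl | hm
  · simp
  have h1 := sum_sq_le_harmonic h Finset.univ
  rw [Finset.card_fin] at h1
  have h2 : (harmonic m : ℝ) ≤ 1 + Real.log n := by
    refine (harmonic_le_one_add_log m).trans ?_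
    gcongr
  have h3 : ∑ i, f i ^ 2 ≤ M ^ 2 * (4 * (1 + Real.log n)) := by nlinarith [sq_nonneg M]
  have h4 : √(∑ i, f i ^ 2) ≤ M * √(4 * (1 + Real.log n)) := by
    refine (Real.sqrt_le_sqrt h3).trans ?_
    rw [Real.sqrt_mul (sq_nonneg M), Real.sqrt_sq hM]
  have h5 : |∑ i, f i * x i| ≤ √(∑ i, f i ^ 2) * √(∑ i, x i ^ 2) := by
    rw [← Real.sqrt_mul (Finset.sum_nonneg fun i _ => sq_nonneg _)]
    exact Real.abs_le_sqrt (Finset.sum_mul_sq_le_sq_mul_sq _ _ _)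
  exact h5.trans (mul_le_mul_of_nonneg_right h4 (Real.sqrt_nonneg _))

/-- A trilinear form that is bounded by `M` on all normalized indicators of boxes is bounded by
`M * √(4 * (1 + log n)) ^ 3` on unit vectors: the three arguments are released one by one. -/
lemma abs_trilinear_le_of_boxes {n₁ n₂ n₃ n : ℕ} (h₁ : n₁ ≤ n) (h₂ : n₂ ≤ n) (h₃ : n₃ ≤ n)
    (E : Fin n₁ → Fin n₂ → Fin n₃ → ℝ) {M : ℝ} (hM : 0 ≤ M)
    (h : ∀ (A : Finset (Fin n₁)) (B : Finset (Fin n₂)) (C : Finset (Fin n₃)),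
      |∑ i ∈ A, ∑ j ∈ B, ∑ k ∈ C, E i j k| ≤ M * (√A.card * √B.card * √C.card))
    (x : Fin n₁ → ℝ) (y : Fin n₂ → ℝ) (z : Fin n₃ → ℝ) :
    |∑ i, ∑ j, ∑ k, E i j k * x i * y j * z k| ≤
      M * √(4 * (1 + Real.log n)) ^ 3 *
        (√(∑ i, x i ^ 2) * √(∑ j, y j ^ 2) * √(∑ k, z k ^ 2)) := by
  set R := √(4 * (1 + Real.log n)) with hR
  have hR0 : 0 ≤ R := Real.sqrt_nonneg _
  have s1 : ∀ (B : Finset (Fin n₂)) (C : Finset (Fin n₃)),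
      |∑ i, (∑ j ∈ B, ∑ k ∈ C, E i j k) * x i| ≤
        M * (√B.card * √C.card) * R * √(∑ i, x i ^ 2) := by
    intro B C
    refine abs_sum_mul_le_of_indicator h₁ (fun A => (h A B C).trans (le_of_eq (by ring)))
      (by positivity) x
  have s2 : ∀ C : Finset (Fin n₃), |∑ j, (∑ i, (∑ k ∈ C, E i j k) * x i) * y j| ≤
        M * √C.card * R * √(∑ i, x i ^ 2) * R * √(∑ j, y j ^ 2) := by
    intro C
    refine abs_sum_mul_le_of_indicator h₂ (fun B => ?_) (by positivity) y
    refine le_trans (le_of_eq ?_) ((s1 B C).trans (le_of_eq (by ring)))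
    rw [Finset.sum_comm]
    simp only [Finset.sum_mul]
  have s3 : |∑ k, (∑ j, (∑ i, E i j k * x i) * y j) * z k| ≤
        M * R * √(∑ i, x i ^ 2) * R * √(∑ j, y j ^ 2) * R * √(∑ k, z k ^ 2) := by
    refine abs_sum_mul_le_of_indicator h₃ (fun C => ?_) (by positivity) z
    refine le_trans (le_of_eq ?_) ((s2 C).trans (le_of_eq (by ring)))
    rw [Finset.sum_comm]
    refine congrArg _ (Finset.sum_congr rfl fun j _ => ?_)
    rw [← Finset.sum_mul, Finset.sum_comm]
    simp only [Finset.sum_mul]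
  refine le_trans (le_of_eq ?_) (s3.trans (le_of_eq (by ring)))
  simp only [Finset.sum_mul]
  congr 1
  calc _ = ∑ i, ∑ k, ∑ j, E i j k * x i * y j * z k :=
        Finset.sum_congr rfl fun i _ => Finset.sum_comm
    _ = ∑ k, ∑ i, ∑ j, E i j k * x i * y j * z k := Finset.sum_comm
    _ = _ := Finset.sum_congr rfl fun k _ => Finset.sum_comm

/-! ### Tail bounds and the trichotomy for boxes -/

/-- `TailRange v K a` says that Bernstein's inequality bounds the probability of a deviation `a` of
a sum of variance `v` by `2 * exp (-K)`: the first alternative is the Poisson range, with exponent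
`a / 12`, the second one the Gaussian range, with exponent `a ^ 2 / (24 * v)`. -/
def TailRange (v K a : ℝ) : Prop :=
  (2 * v ≤ a ∧ 12 * K ≤ a) ∨ (a < 2 * v ∧ 24 * v * K ≤ a ^ 2)

open Classical in
/-- Bernstein's inequality: the Chernoff bound, applied to `w` and to `-w`, with `θ = 1 / 6` in the
Poisson range and `θ = a / (12 * p * |U|)` in the Gaussian range. -/
lemma setBernoulli_abs_tail {ι β : Type*} [Fintype ι] [Fintype β] {u : Set ι} (p : unitInterval)
    {q : β → ι} (hq : ∀ x, q x ∈ u) (hfib : ∀ s, (Finset.univ.filter fun x => q x = s).card ≤ 6)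
    {w : β → ℝ} (hw : ∀ x, |w x| ≤ 1) (U : Finset β) {a K : ℝ} (ha : 0 ≤ a)
    (h : TailRange (p * U.card) K a) :
    (setBernoulli u p).real
        {ω | a ≤ |∑ x ∈ U, w x * ((if q x ∈ ω then 1 else 0) - (p : ℝ))|} ≤
      2 * Real.exp (-K) := by
  obtain ⟨θ, h0, h6, hθ⟩ : ∃ θ : ℝ, 0 ≤ θ ∧ θ ≤ 1 / 6 ∧
      -θ * a + 6 * p * θ ^ 2 * U.card ≤ -K := by
    rcases h with ⟨h1, h2⟩ | ⟨h1, h2⟩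
    · exact ⟨1 / 6, by norm_num, le_rfl, by nlinarith⟩
    · have hv : 0 < (p : ℝ) * U.card := by linarith
      refine ⟨a / (12 * (p * U.card)), by positivity, ?_, ?_⟩
      · rw [div_le_div_iff₀ (by positivity) (by norm_num)]
        linarith
      · have e : -(a / (12 * (p * U.card))) * a + 6 * p * (a / (12 * (p * U.card))) ^ 2 * U.card =
            -(a ^ 2 / (24 * (p * U.card))) := by
          have hp : (p : ℝ) ≠ 0 := left_ne_zero_of_mul hv.ne'
          have hU : (U.card : ℝ) ≠ 0 := right_ne_zero_of_mul hv.ne'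
          field_simp
          ring
        rw [e, neg_le_neg_iff, le_div_iff₀ (by positivity)]
        linarith
  have hpos := (setBernoulli_tail p hq hfib hw U h0 h6 a).trans (Real.exp_le_exp.2 hθ)
  have hneg := (setBernoulli_tail p hq hfib (w := fun x => -w x) (by simpa using hw) U h0 h6
    a).trans (Real.exp_le_exp.2 hθ)
  rw [two_mul]
  refine le_trans ?_ (add_le_add hpos hneg)
  refine (measureReal_mono ?_).trans (measureReal_union_le _ _)
  intro ω hω
  simp only [Set.mem_ofPred_eq, Set.mem_union, neg_mul, Finset.sum_neg_distrib] at hω ⊢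
  exact le_abs.1 hω

/-- The trichotomy behind the bound on boxes. Here `m` is the longest side of the box, `r` the
product of the other two sides, `d` the dimension containing the longest side and `N` the number of
all entries. Unless one of the two tail bounds beats the number of boxes, the box is so
thin that the degrees `2 * p * d + 60 * L` of its `r` lines suffice. -/
lemma box_trichotomy {p L N κ m r d : ℝ} (hp : 0 ≤ p) (hL : 0 < L) (hκ : 0 < κ) (hN : 0 ≤ N)
    (hm : 0 < m) (hr : 0 < r) (hmd : m ≤ d) (hd : d ^ 2 ≤ κ * N) (hpL : L ≤ p * √N) :
    let a := 180 * (1 + κ) * √(√N * p * L) * √(m * r)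
    TailRange (p * (m * r)) (15 * m * L) a ∨ r * (2 * p * d + 60 * L) + p * (m * r) ≤ a := by
  intro a
  set s := √N with hs
  have hs0 : 0 ≤ s := Real.sqrt_nonneg _
  have hss : s ^ 2 = N := Real.sq_sqrt hN
  set X := s * p * L * (m * r) with hX
  have hX0 : 0 ≤ X := by positivity
  have haX : a = 180 * (1 + κ) * √X := by
    rw [hX, Real.sqrt_mul (by positivity)]
    ring
  have ha2 : a ^ 2 = 180 ^ 2 * (1 + κ) ^ 2 * X := by
    rw [haX, mul_pow, mul_pow, Real.sq_sqrt hX0]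
  have ha0 : 0 ≤ a := by rw [haX]; positivity
  -- `m ≤ d ≤ √κ * √N ≤ (1 + κ) * √N`
  have hds : d ≤ (1 + κ) * s := by
    refine le_of_sq_le_sq ?_ (by positivity)
    rw [mul_pow, hss]
    nlinarith [mul_nonneg hκ.le hN, mul_nonneg (sq_nonneg κ) hN]
  by_cases h1 : 2 * (p * (m * r)) ≤ a
  · by_cases h2 : 12 * (15 * m * L) ≤ a
    · exact Or.inl (Or.inl ⟨h1, h2⟩)
    · refine Or.inr ?_
      have h3 : a ^ 2 < (12 * (15 * m * L)) ^ 2 := pow_lt_pow_left₀ (not_le.1 h2) ha0 (by norm_num)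
      have h4 : (1 + κ) ^ 2 * (s * p * r) ≤ m * L := by
        have hmL : 0 < m * L := by positivity
        refine le_of_mul_le_mul_right ?_ hmL
        rw [ha2, hX] at h3
        nlinarith
      have hspr : 0 ≤ s * p * r := by positivity
      -- `h4` says that `r` is small compared with `m`; `h5` and `h6` bound the two parts of the
      -- degree, the second one by means of `d ^ 2 ≤ κ * N`
      have h5 : (r * L) ^ 2 ≤ X := by
        have e1 : r * L ≤ s * p * r := by nlinarith
        have e2 : s * p * r ≤ m * L := by nlinarith [mul_nonneg hκ.le hspr, mul_nonneg (sq_nonneg κ) hspr]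
        calc (r * L) ^ 2 = (r * L) * (r * L) := sq _
          _ ≤ (m * L) * (s * p * r) := by
              apply mul_le_mul (e1.trans e2) e1 <;> positivity
          _ = X := by rw [hX]; ring
      have h6 : (r * p * d) ^ 2 ≤ X := by
        have e1 : d ^ 2 ≤ (1 + κ) ^ 2 * s ^ 2 := by
          rw [← mul_pow]
          exact pow_le_pow_left₀ (hm.le.trans hmd) hds 2
        calc (r * p * d) ^ 2 = (r * p) ^ 2 * d ^ 2 := by ring
          _ ≤ (r * p) ^ 2 * ((1 + κ) ^ 2 * s ^ 2) := mul_le_mul_of_nonneg_left e1 (sq_nonneg _)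
          _ = (s * p * r) * ((1 + κ) ^ 2 * (s * p * r)) := by ring
          _ ≤ (s * p * r) * (m * L) := mul_le_mul_of_nonneg_left h4 hspr
          _ = X := by rw [hX]; ring
      have h7 := Real.le_sqrt_of_sq_le h5
      have h8 := Real.le_sqrt_of_sq_le h6
      have h9 : 180 * √X ≤ a := by
        rw [haX]
        nlinarith [Real.sqrt_nonneg X, mul_nonneg hκ.le (Real.sqrt_nonneg X)]
      nlinarith [Real.sqrt_nonneg X]
  · refine Or.inl (Or.inr ⟨not_le.1 h1, ?_⟩)
    rw [ha2, hX]
    have h2 : 360 * m ≤ 180 ^ 2 * (1 + κ) ^ 2 * s := by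
      nlinarith [mul_nonneg hκ.le hs0, mul_nonneg (sq_nonneg κ) hs0]
    have h3 : 0 ≤ p * L * (m * r) := by positivity
    nlinarith

/-- The generating function of the number of subsets by size: weighting a set `A` by `n ^ (-|A|)`
makes the union bound over all sets of one index summable. -/
lemma sum_one_div_pow_card_le {m n : ℕ} (hmn : m ≤ n) (hn : 0 < n) :
    ∑ A : Finset (Fin m), (1 / n : ℝ) ^ A.card ≤ 3 := by
  have h := Fintype.sum_pow_mul_eq_add_pow (Fin m) (1 / n : ℝ) 1
  simp only [one_pow, mul_one, Fintype.card_fin] at h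
  have hn' : (0 : ℝ) < n := by exact_mod_cast hn
  rw [h]
  calc (1 / n + 1 : ℝ) ^ m ≤ (1 / n + 1 : ℝ) ^ n :=
        pow_le_pow_right₀ (by linarith [one_div_pos.2 hn']) hmn
    _ ≤ (Real.exp (1 / n)) ^ n := pow_le_pow_left₀ (by positivity) (Real.add_one_le_exp _) n
    _ = Real.exp 1 := by
        rw [← Real.exp_nat_mul]
        congr 1
        field_simp
    _ ≤ 3 := by linarith [Real.exp_one_lt_d9]

open Classical in
/-- The number of sampled points in a set `U` is
less than `2 * p * U.card + 60 * log n`, up to probability `n ^ (-10)`. -/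
lemma setBernoulli_degree_tail {ι β : Type*} [Fintype ι] [Fintype β] {u : Set ι} (p : unitInterval)
    {q : β → ι} (hq : ∀ x, q x ∈ u) (hfib : ∀ s, (Finset.univ.filter fun x => q x = s).card ≤ 6)
    (U : Finset β) {n : ℕ} (hn : 0 < n) :
    (setBernoulli u p).real
        {ω | 2 * (p : ℝ) * U.card + 60 * Real.log n ≤ ∑ x ∈ U, (if q x ∈ ω then 1 else 0 : ℝ)} ≤
      (1 / n : ℝ) ^ 10 := by
  have hn' : (0 : ℝ) < n := by exact_mod_cast hn
  have h := setBernoulli_tail p hq hfib (w := fun _ => 1) (by simp) U (θ := 1 / 6) (by norm_num)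
    le_rfl (p * U.card + 60 * Real.log n)
  refine (measureReal_mono ?_).trans (h.trans (le_of_eq ?_))
  · intro ω hω
    simp only [Set.mem_ofPred_eq, one_mul, Finset.sum_sub_distrib, Finset.sum_const,
      nsmul_eq_mul] at hω ⊢
    linarith
  · have e : -(1 / 6 : ℝ) * (p * U.card + 60 * Real.log n) + 6 * p * (1 / 6) ^ 2 * U.card =
        (10 : ℕ) * -Real.log n := by push_cast; ring
    rw [e, Real.exp_nat_mul, Real.exp_neg, Real.exp_log hn', one_div]

/-! ### Uniform deviation over all boxes -/

lemma sum_box_le_of_lines {α β γ : Type*} [Fintype α] {X : α → β → γ → ℝ}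
    (hX : ∀ i j k, 0 ≤ X i j k) {D : ℝ} (h : ∀ j k, ∑ i, X i j k ≤ D)
    (A : Finset α) (B : Finset β) (C : Finset γ) :
    ∑ i ∈ A, ∑ j ∈ B, ∑ k ∈ C, X i j k ≤ (B.card * C.card : ℝ) * D := by
  have e : ∑ i ∈ A, ∑ j ∈ B, ∑ k ∈ C, X i j k = ∑ j ∈ B, ∑ k ∈ C, ∑ i ∈ A, X i j k := by
    rw [Finset.sum_comm]
    exact Finset.sum_congr rfl fun j _ => Finset.sum_comm
  rw [e]
  calc ∑ j ∈ B, ∑ k ∈ C, ∑ i ∈ A, X i j k ≤ ∑ j ∈ B, ∑ k ∈ C, D := by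
        refine Finset.sum_le_sum fun j _ => Finset.sum_le_sum fun k _ => ?_
        exact (Finset.sum_le_univ_sum_of_nonneg fun i => hX i j k).trans (h j k)
    _ = _ := by simp [mul_assoc]

lemma abs_sum_box_le {β : Type*} {w X : β → ℝ} (hw : ∀ x, |w x| ≤ 1) (hX : ∀ x, 0 ≤ X x)
    {p : ℝ} (hp : 0 ≤ p) (U : Finset β) :
    |∑ x ∈ U, w x * (X x - p)| ≤ ∑ x ∈ U, X x + p * U.card := by
  calc |∑ x ∈ U, w x * (X x - p)| ≤ ∑ x ∈ U, |w x * (X x - p)| := Finset.abs_sum_le_sum_abs _ _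
    _ ≤ ∑ x ∈ U, (X x + p) := by
        refine Finset.sum_le_sum fun x _ => ?_
        rw [abs_mul]
        have : |X x - p| ≤ X x + p := abs_le.2 ⟨by linarith [hX x], by linarith⟩
        exact (mul_le_of_le_one_left (abs_nonneg _) (hw x)).trans this
    _ = _ := by simp [Finset.sum_add_distrib, mul_comm]

/-- A box outside the range of the tail bounds is so thin that the degrees of its lines in the
longest direction control its deviation. -/
lemma abs_sum_box_le_of_degrees {n₁ n₂ n₃ : ℕ} {p L κ : ℝ} (hp : 0 ≤ p) (hL : 0 < L) (hκ : 0 < κ)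
    (hd₁ : (n₁ : ℝ) ^ 2 ≤ κ * (n₁ * n₂ * n₃)) (hd₂ : (n₂ : ℝ) ^ 2 ≤ κ * (n₁ * n₂ * n₃))
    (hd₃ : (n₃ : ℝ) ^ 2 ≤ κ * (n₁ * n₂ * n₃)) (hpL : L ≤ p * √(n₁ * n₂ * n₃ : ℝ))
    {w X : Triple n₁ n₂ n₃ → ℝ} (hw : ∀ x, |w x| ≤ 1) (hX : ∀ x, 0 ≤ X x)
    (g₁ : ∀ j k, ∑ i, X (i, j, k) ≤ 2 * p * n₁ + 60 * L)
    (g₂ : ∀ i k, ∑ j, X (i, j, k) ≤ 2 * p * n₂ + 60 * L)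
    (g₃ : ∀ i j, ∑ k, X (i, j, k) ≤ 2 * p * n₃ + 60 * L)
    {A : Finset (Fin n₁)} {B : Finset (Fin n₂)} {C : Finset (Fin n₃)}
    (hA : A.Nonempty) (hB : B.Nonempty) (hC : C.Nonempty)
    (hT : ¬ TailRange (p * (A ×ˢ B ×ˢ C).card)
      (15 * max (A.card : ℝ) (max B.card C.card) * L)
      (180 * (1 + κ) * √(√(n₁ * n₂ * n₃ : ℝ) * p * L) * (√A.card * √B.card * √C.card))) :
    |∑ x ∈ A ×ˢ B ×ˢ C, w x * (X x - p)| ≤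
      180 * (1 + κ) * √(√(n₁ * n₂ * n₃ : ℝ) * p * L) * (√A.card * √B.card * √C.card) := by
  have hN : (0 : ℝ) ≤ n₁ * n₂ * n₃ := by positivity
  have hA0 : (0 : ℝ) < A.card := by exact_mod_cast hA.card_pos
  have hB0 : (0 : ℝ) < B.card := by exact_mod_cast hB.card_pos
  have hC0 : (0 : ℝ) < C.card := by exact_mod_cast hC.card_pos
  have hA1 : (A.card : ℝ) ≤ n₁ := by exact_mod_cast card_finset_fin_le A
  have hB1 : (B.card : ℝ) ≤ n₂ := by exact_mod_cast card_finset_fin_le B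
  have hC1 : (C.card : ℝ) ≤ n₃ := by exact_mod_cast card_finset_fin_le C
  have hcard : ((A ×ˢ B ×ˢ C).card : ℝ) = A.card * (B.card * C.card) := by
    rw [Finset.card_product, Finset.card_product]; push_cast; rfl
  have hsq : √A.card * √B.card * √C.card = √(A.card * (B.card * C.card) : ℝ) := by
    rw [Real.sqrt_mul hA0.le, Real.sqrt_mul hB0.le, mul_assoc]
  rw [hcard, hsq] at hT
  rw [hsq]
  refine (abs_sum_box_le hw hX hp (A ×ˢ B ×ˢ C)).trans ?_
  simp only [Finset.sum_product]
  rw [hcard]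
  -- the longest side decides which of the three families of lines is used
  rcases le_total (A.card : ℝ) (max B.card C.card) with hABC | hABC
  · rcases le_total (B.card : ℝ) C.card with hBC | hBC
    · have key := box_trichotomy (r := A.card * B.card) hp hL hκ hN hC0 (by positivity) hC1 hd₃ hpL
      have e1 : (C.card : ℝ) * (A.card * B.card) = A.card * (B.card * C.card) := by ring
      simp only [e1] at key
      rw [max_eq_right hABC, max_eq_right hBC] at hT
      refine le_trans (add_le_add ?_ le_rfl) (key.resolve_left hT)
      refine le_trans (le_of_eq ?_) (sum_box_le_of_lines (X := fun k i j => X (i, j, k))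
        (fun _ _ _ => hX _) g₃ C A B)
      rw [Finset.sum_comm (s := C)]
      exact Finset.sum_congr rfl fun i _ => Finset.sum_comm
    · have key := box_trichotomy (r := A.card * C.card) hp hL hκ hN hB0 (by positivity) hB1 hd₂ hpL
      have e1 : (B.card : ℝ) * (A.card * C.card) = A.card * (B.card * C.card) := by ring
      simp only [e1] at key
      rw [max_eq_right hABC, max_eq_left hBC] at hT
      refine le_trans (add_le_add ?_ le_rfl) (key.resolve_left hT)
      refine le_trans (le_of_eq Finset.sum_comm) (sum_box_le_of_lines (X := fun j i k => X (i, j, k))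
        (fun _ _ _ => hX _) g₂ B A C)
  · have key := box_trichotomy (r := B.card * C.card) hp hL hκ hN hA0 (by positivity) hA1 hd₁ hpL
    rw [max_eq_left hABC] at hT
    refine le_trans (add_le_add ?_ le_rfl) (key.resolve_left hT)
    exact sum_box_le_of_lines (X := fun i j k => X (i, j, k)) (fun _ _ _ => hX _) g₁ A B C

open Classical in
/-- With probability at least `1 - n ^ (-5)` every box satisfies the deviation bound. The union
bound runs over the boxes covered by a tail bound and over the lines of the three directions;
the remaining boxes are controlled by the degrees of their lines in the longest direction. -/
theorem box_deviation {n₁ n₂ n₃ n : ℕ} (hn : 2 ≤ n) (h₁ : n₁ ≤ n) (h₂ : n₂ ≤ n) (h₃ : n₃ ≤ n)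
    {ι : Type*} [Fintype ι] {u : Set ι} (p : unitInterval) {q : Triple n₁ n₂ n₃ → ι}
    (hq : ∀ x, q x ∈ u) (hfib : ∀ s, (Finset.univ.filter fun x => q x = s).card ≤ 6)
    {κ : ℝ} (hκ : 0 < κ) (hd₁ : (n₁ : ℝ) ^ 2 ≤ κ * (n₁ * n₂ * n₃))
    (hd₂ : (n₂ : ℝ) ^ 2 ≤ κ * (n₁ * n₂ * n₃)) (hd₃ : (n₃ : ℝ) ^ 2 ≤ κ * (n₁ * n₂ * n₃))
    (hpL : Real.log n ≤ p * √(n₁ * n₂ * n₃ : ℝ)) {w : Triple n₁ n₂ n₃ → ℝ}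
    (hw : ∀ x, |w x| ≤ 1) :
    1 - 1 / (n : ℝ) ^ 5 ≤ (setBernoulli u p).real
      {ω | ∀ (A : Finset (Fin n₁)) (B : Finset (Fin n₂)) (C : Finset (Fin n₃)),
        |∑ x ∈ A ×ˢ B ×ˢ C, w x * ((if q x ∈ ω then 1 else 0) - (p : ℝ))| ≤
          180 * (1 + κ) * √(√(n₁ * n₂ * n₃ : ℝ) * p * Real.log n) *
            (√A.card * √B.card * √C.card)} := by
  set L := Real.log n with hLdef
  set N : ℝ := n₁ * n₂ * n₃ with hNdef
  have hN0 : 0 ≤ N := by positivity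
  have hp0 : (0 : ℝ) ≤ p := p.2.1
  have hn2 : (2 : ℝ) ≤ n := by exact_mod_cast hn
  have hn0 : (0 : ℝ) < n := by linarith
  have hL : 0 < L := Real.log_pos (by linarith)
  set c := 180 * (1 + κ) * √(√N * p * L)
  have hc0 : 0 ≤ c := by positivity
  let S : Finset (Fin n₁) × Finset (Fin n₂) × Finset (Fin n₃) → Set ι → ℝ := fun D ω =>
    |∑ x ∈ D.1 ×ˢ D.2.1 ×ˢ D.2.2, w x * ((if q x ∈ ω then 1 else 0) - (p : ℝ))|
  let t : Finset (Fin n₁) × Finset (Fin n₂) × Finset (Fin n₃) → ℝ := fun D =>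
    c * (√D.1.card * √D.2.1.card * √D.2.2.card)
  let m : Finset (Fin n₁) × Finset (Fin n₂) × Finset (Fin n₃) → ℝ := fun D =>
    max (D.1.card : ℝ) (max D.2.1.card D.2.2.card)
  let Tail : Finset (Fin n₁) × Finset (Fin n₂) × Finset (Fin n₃) → Prop := fun D =>
    1 ≤ m D ∧ TailRange (p * (D.1 ×ˢ D.2.1 ×ˢ D.2.2).card) (15 * m D * L) (t D)
  let bad : Finset (Fin n₁) × Finset (Fin n₂) × Finset (Fin n₃) → Set (Set ι) := fun D =>
    if Tail D then {ω | t D ≤ S D ω} else ∅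
  let deg : Finset (Triple n₁ n₂ n₃) → Set (Set ι) := fun U =>
    {ω | 2 * (p : ℝ) * U.card + 60 * L ≤ ∑ x ∈ U, (if q x ∈ ω then 1 else 0 : ℝ)}
  let l₁ : Fin n₂ × Fin n₃ → Finset (Triple n₁ n₂ n₃) := fun y =>
    Finset.univ ×ˢ {y.1} ×ˢ {y.2}
  let l₂ : Fin n₁ × Fin n₃ → Finset (Triple n₁ n₂ n₃) := fun y =>
    {y.1} ×ˢ Finset.univ ×ˢ {y.2}
  let l₃ : Fin n₁ × Fin n₂ → Finset (Triple n₁ n₂ n₃) := fun y =>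
    {y.1} ×ˢ {y.2} ×ˢ Finset.univ
  have hbad : ∀ D, (setBernoulli u p).real (bad D) ≤
      2 * (1 / n : ℝ) ^ 12 * ((1 / n : ℝ) ^ D.1.card * ((1 / n : ℝ) ^ D.2.1.card *
        (1 / n : ℝ) ^ D.2.2.card)) := by
    intro D
    by_cases hT : Tail D
    · simp only [bad, if_pos hT]
      have h := setBernoulli_abs_tail p hq hfib hw (D.1 ×ˢ D.2.1 ×ˢ D.2.2) (a := t D)
        (K := 15 * m D * L) (by positivity) hT.2
      refine h.trans ?_
      -- with `a + b + c ≤ 3 * m` and `1 ≤ m`, the exponent `15 * m` covers `12 + a + b + c`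
      rw [mul_assoc (2 : ℝ), ← pow_add, ← pow_add, ← pow_add]
      refine mul_le_mul_of_nonneg_left ?_ (by norm_num)
      have e : (1 / n : ℝ) ^ (12 + (D.1.card + (D.2.1.card + D.2.2.card))) =
          Real.exp (((12 + (D.1.card + (D.2.1.card + D.2.2.card)) : ℕ) : ℝ) * -L) := by
        rw [Real.exp_nat_mul, Real.exp_neg, Real.exp_log hn0, one_div]
      rw [e, Real.exp_le_exp]
      push_cast
      have m1 : (D.1.card : ℝ) ≤ m D := le_max_left _ _
      have m2 : (D.2.1.card : ℝ) ≤ m D := (le_max_left _ _).trans (le_max_right _ _)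
      have m3 : (D.2.2.card : ℝ) ≤ m D := (le_max_right _ _).trans (le_max_right _ _)
      nlinarith [hT.1]
    · simp only [bad, if_neg hT, measureReal_empty]
      positivity
  have hdeg : ∀ U, (setBernoulli u p).real (deg U) ≤ (1 / n : ℝ) ^ 10 := fun U =>
    setBernoulli_degree_tail p hq hfib U (by omega)
  have hbadU : (setBernoulli u p).real (⋃ D, bad D) ≤ 54 * (1 / n : ℝ) ^ 12 := by
    refine (measureReal_iUnion_fintype_le _).trans ((Finset.sum_le_sum fun D _ => hbad D).trans ?_)
    rw [← Finset.mul_sum, Fintype.sum_prod_type]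
    simp only [Fintype.sum_prod_type, ← Finset.mul_sum, ← Finset.sum_mul]
    have s1 := sum_one_div_pow_card_le h₁ (by omega)
    have s2 := sum_one_div_pow_card_le h₂ (by omega)
    have s3 := sum_one_div_pow_card_le h₃ (by omega)
    have s23 := mul_le_mul s2 s3 (Finset.sum_nonneg fun _ _ => by positivity) (by norm_num)
    have s123 := mul_le_mul s1 s23 (mul_nonneg (Finset.sum_nonneg fun _ _ => by positivity)
      (Finset.sum_nonneg fun _ _ => by positivity)) (by norm_num)
    have := mul_le_mul_of_nonneg_left s123 (a := 2 * (1 / n : ℝ) ^ 12) (by positivity)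
    linarith
  have hlines : ∀ {a b : ℕ} (l : Fin a × Fin b → Finset (Triple n₁ n₂ n₃)), a ≤ n → b ≤ n →
      (setBernoulli u p).real (⋃ y, deg (l y)) ≤ (1 / n : ℝ) ^ 8 := by
    intro a b l ha hb
    refine (measureReal_iUnion_fintype_le _).trans
      ((Finset.sum_le_sum fun y _ => hdeg (l y)).trans ?_)
    rw [Finset.sum_const, Finset.card_univ, Fintype.card_prod, Fintype.card_fin, Fintype.card_fin,
      nsmul_eq_mul]
    have : ((a * b : ℕ) : ℝ) ≤ (n : ℝ) ^ 2 := by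
      rw [sq]
      exact_mod_cast Nat.mul_le_mul ha hb
    calc _ ≤ (n : ℝ) ^ 2 * (1 / n : ℝ) ^ 10 := by gcongr
      _ = _ := by field_simp
  set W := (⋃ D, bad D) ∪ ((⋃ y, deg (l₁ y)) ∪ ((⋃ y, deg (l₂ y)) ∪ ⋃ y, deg (l₃ y))) with hW
  have hWle : (setBernoulli u p).real W ≤ 1 / (n : ℝ) ^ 5 := by
    have h : (setBernoulli u p).real W ≤
        54 * (1 / n : ℝ) ^ 12 + ((1 / n : ℝ) ^ 8 + ((1 / n : ℝ) ^ 8 + (1 / n : ℝ) ^ 8)) := by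
      refine (measureReal_union_le _ _).trans (add_le_add hbadU ?_)
      refine (measureReal_union_le _ _).trans (add_le_add (hlines l₁ h₂ h₃) ?_)
      exact (measureReal_union_le _ _).trans (add_le_add (hlines l₂ h₁ h₃) (hlines l₃ h₁ h₂))
    refine h.trans ?_
    have hr0 : (0 : ℝ) ≤ 1 / n := by positivity
    have hr : (1 / n : ℝ) ≤ 1 / 2 := one_div_le_one_div_of_le (by norm_num) hn2
    have e3 : (1 / n : ℝ) ^ 3 ≤ (1 / 2) ^ 3 := pow_le_pow_left₀ hr0 hr 3
    have e7 : (1 / n : ℝ) ^ 7 ≤ (1 / 2) ^ 7 := pow_le_pow_left₀ hr0 hr 7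
    have e5 : 1 / (n : ℝ) ^ 5 = (1 / n : ℝ) ^ 5 := by rw [div_pow, one_pow]
    rw [e5]
    have e0 : (0 : ℝ) ≤ (1 / n : ℝ) ^ 5 := by positivity
    calc _ = (1 / n : ℝ) ^ 5 * (54 * (1 / n : ℝ) ^ 7 + 3 * (1 / n : ℝ) ^ 3) := by ring
      _ ≤ (1 / n : ℝ) ^ 5 * 1 := mul_le_mul_of_nonneg_left (by norm_num at e3 e7 ⊢; linarith) e0
      _ = _ := mul_one _
  have huniv : (1 : ℝ) ≤ (setBernoulli u p).real Wᶜ + (setBernoulli u p).real W := by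
    rw [← probReal_univ (μ := setBernoulli u p), ← Set.compl_union_self W]
    exact measureReal_union_le _ _
  refine le_trans (by linarith) (measureReal_mono (s₁ := Wᶜ) ?_)
  intro ω hω A B C
  rw [hW] at hω
  simp only [Set.compl_union, Set.compl_iUnion, Set.mem_inter_iff, Set.mem_iInter,
    Set.mem_compl_iff] at hω
  obtain ⟨g0, g1, g2, g3⟩ := hω
  rcases A.eq_empty_or_nonempty with rfl | hA
  · simp
  rcases B.eq_empty_or_nonempty with rfl | hB
  · simp
  rcases C.eq_empty_or_nonempty with rfl | hC
  · simp
  have hmle : 1 ≤ m (A, B, C) :=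
    le_trans (by exact_mod_cast hA.card_pos) (le_max_left (A.card : ℝ) _)
  by_cases hT : Tail (A, B, C)
  · have := g0 (A, B, C)
    simp only [bad, if_pos hT, Set.mem_ofPred_eq, not_le] at this
    exact this.le
  · refine abs_sum_box_le_of_degrees (X := fun x => if q x ∈ ω then 1 else 0) hp0 hL hκ hd₁ hd₂ hd₃
      hpL hw (fun x => by split_ifs <;> norm_num) (fun j k => ?_) (fun i k => ?_) (fun i j => ?_)
      hA hB hC fun h => hT ⟨hmle, h⟩
    · have := g1 (j, k)
      simp only [deg, l₁, Set.mem_ofPred_eq, not_le, Finset.sum_product,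
        Finset.card_product, Finset.sum_singleton, Finset.card_singleton, mul_one,
        Finset.card_univ, Fintype.card_fin] at this
      exact this.le
    · have := g2 (i, k)
      simp only [deg, l₂, Set.mem_ofPred_eq, not_le, Finset.sum_product,
        Finset.card_product, Finset.sum_singleton, Finset.card_singleton, one_mul, mul_one,
        Finset.card_univ, Fintype.card_fin] at this
      exact this.le
    · have := g3 (i, j)
      simp only [deg, l₃, Set.mem_ofPred_eq, not_le, Finset.sum_product,
        Finset.card_product, Finset.sum_singleton, Finset.card_singleton, one_mul,
        Finset.card_univ, Fintype.card_fin] at this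
      exact this.le

/-! ### Deviation of the trilinear form -/

lemma Tensor3.maxEntry_nonneg {n₁ n₂ n₃ : ℕ} (T : Tensor3 n₁ n₂ n₃) : 0 ≤ T.maxEntry :=
  Real.iSup_nonneg fun _ => abs_nonneg _

lemma Tensor3.abs_le_maxEntry {n₁ n₂ n₃ : ℕ} (T : Tensor3 n₁ n₂ n₃) (t : Triple n₁ n₂ n₃) :
    |T t.1 t.2.1 t.2.2| ≤ T.maxEntry :=
  le_ciSup (f := fun t : Triple n₁ n₂ n₃ => |T t.1 t.2.1 t.2.2|) (Set.finite_range _).bddAbove t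

open Classical in
/-- The deviation bound for the sample `{t | q t ∈ ω}`. Independent sampling is the case
`q = id`, symmetric sampling the case where `q` sorts a triple. -/
theorem form_deviation {n₁ n₂ n₃ n : ℕ} (hn : 2 ≤ n) (h₁ : n₁ ≤ n) (h₂ : n₂ ≤ n) (h₃ : n₃ ≤ n)
    {ι : Type*} [Fintype ι] {u : Set ι} (p : unitInterval) {q : Triple n₁ n₂ n₃ → ι}
    (hq : ∀ x, q x ∈ u) (hfib : ∀ s, (Finset.univ.filter fun x => q x = s).card ≤ 6)
    {κ : ℝ} (hκ : 0 < κ) (hd₁ : (n₁ : ℝ) ^ 2 ≤ κ * (n₁ * n₂ * n₃))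
    (hd₂ : (n₂ : ℝ) ^ 2 ≤ κ * (n₁ * n₂ * n₃)) (hd₃ : (n₃ : ℝ) ^ 2 ≤ κ * (n₁ * n₂ * n₃))
    (hpL : Real.log n ≤ p * √(n₁ * n₂ * n₃ : ℝ)) (T : Tensor3 n₁ n₂ n₃) :
    1 - 1 / (n : ℝ) ^ 5 ≤ (setBernoulli u p).real
      {ω | ∀ Ω : Set (Triple n₁ n₂ n₃), (∀ t, t ∈ Ω ↔ q t ∈ ω) →
        ∀ (x : EuclideanSpace ℝ (Fin n₁)) (y : EuclideanSpace ℝ (Fin n₂))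
          (z : EuclideanSpace ℝ (Fin n₃)), ‖x‖ = 1 → ‖y‖ = 1 → ‖z‖ = 1 →
          (T.proj Ω - (p : ℝ) • T).form x y z ≤ 5760 * (1 + κ) * T.maxEntry * Real.log n ^ 2 *
            √(√(n₁ * n₂ * n₃ : ℝ) * p)} := by
  have hM := T.maxEntry_nonneg
  have hp0 : (0 : ℝ) ≤ p := p.2.1
  set w : Triple n₁ n₂ n₃ → ℝ := fun t => T t.1 t.2.1 t.2.2 / T.maxEntry with hw
  have hw1 : ∀ t, |w t| ≤ 1 := fun t => by
    rw [hw, abs_div, abs_of_nonneg hM]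
    exact div_le_one_of_le₀ (T.abs_le_maxEntry t) hM
  -- if `T.maxEntry = 0`, then `w = 0` by division by zero, and `T = 0` as well
  have hTw : ∀ t, T t.1 t.2.1 t.2.2 = T.maxEntry * w t := fun t => by
    rcases eq_or_ne T.maxEntry 0 with h0 | h0
    · have := T.abs_le_maxEntry t
      rw [h0] at this ⊢
      rw [zero_mul, abs_nonpos_iff.1 this]
    · rw [hw]; field_simp
  refine (box_deviation hn h₁ h₂ h₃ p hq hfib hκ hd₁ hd₂ hd₃ hpL hw1).trans (measureReal_mono ?_)
  intro ω hω Ω hΩ x y z hx hy hz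
  have hL : 0.69 < Real.log n := by
    have : Real.log 2 ≤ Real.log n := Real.log_le_log (by norm_num) (by exact_mod_cast hn)
    linarith [Real.log_two_gt_d9]
  have htri := abs_trilinear_le_of_boxes h₁ h₂ h₃
    (fun i j k => w (i, j, k) * ((if q (i, j, k) ∈ ω then 1 else 0) - (p : ℝ)))
    (M := 180 * (1 + κ) * √(√(n₁ * n₂ * n₃ : ℝ) * p * Real.log n)) (by positivity)
    (fun A B C => by simpa only [Finset.sum_product] using hω A B C) x y z
  simp only [← Real.norm_eq_abs, ← EuclideanSpace.real_norm_sq_eq] at htri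
  rw [hx, hy, hz, Real.norm_eq_abs] at htri
  set L := Real.log n
  have hR : 180 * (1 + κ) * √(√(n₁ * n₂ * n₃ : ℝ) * p * L) * √(4 * (1 + L)) ^ 3 ≤
      5760 * (1 + κ) * L ^ 2 * √(√(n₁ * n₂ * n₃ : ℝ) * p) := by
    have h1 : √(4 * (1 + L)) ≤ √10 * √L := by
      rw [← Real.sqrt_mul (by norm_num)]
      exact Real.sqrt_le_sqrt (by linarith)
    have h2 : √(10 : ℝ) ≤ 3.17 := Real.sqrt_le_iff.2 (by norm_num)
    have h3 : √(4 * (1 + L)) ≤ 3.17 * √L :=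
      h1.trans (mul_le_mul_of_nonneg_right h2 (Real.sqrt_nonneg _))
    have h4 : √(4 * (1 + L)) ^ 3 ≤ 32 * (L * √L) := by
      refine (pow_le_pow_left₀ (Real.sqrt_nonneg _) h3 3).trans ?_
      have e : √L ^ 3 = L * √L := by rw [pow_succ, Real.sq_sqrt (by linarith)]
      rw [mul_pow, e]
      exact mul_le_mul_of_nonneg_right (by norm_num) (by positivity)
    have h5 : √L * √L = L := Real.mul_self_sqrt (by linarith)
    rw [Real.sqrt_mul (by positivity) L]
    calc _ ≤ 180 * (1 + κ) * (√(√(n₁ * n₂ * n₃ : ℝ) * p) * √L) * (32 * (L * √L)) :=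
          mul_le_mul_of_nonneg_left h4 (by positivity)
      _ = 5760 * (1 + κ) * (√(√(n₁ * n₂ * n₃ : ℝ) * p)) * L * (√L * √L) := by ring
      _ = _ := by rw [h5]; ring
  have hform : (T.proj Ω - (p : ℝ) • T).form x y z = T.maxEntry * ∑ i, ∑ j, ∑ k,
      w (i, j, k) * ((if q (i, j, k) ∈ ω then 1 else 0) - (p : ℝ)) * x i * y j * z k := by
    simp only [Tensor3.form, Finset.mul_sum]
    refine Finset.sum_congr rfl fun i _ => Finset.sum_congr rfl fun j _ =>
      Finset.sum_congr rfl fun k _ => ?_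
    have := hTw (i, j, k)
    simp only [Pi.sub_apply, Pi.smul_apply, smul_eq_mul, Tensor3.proj, hΩ] at this ⊢
    rw [this]
    split_ifs <;> ring
  rw [hform]
  have := (le_abs_self _).trans htri
  simp only [one_pow, Real.sqrt_one, mul_one] at this
  calc _ ≤ T.maxEntry * (5760 * (1 + κ) * L ^ 2 * √(√(n₁ * n₂ * n₃ : ℝ) * p)) :=
        mul_le_mul_of_nonneg_left (this.trans hR) hM
    _ = _ := by ring

/-! ### Symmetric sampling as sorting -/

/-- The nondecreasing rearrangement of a triple. -/
def sortTriple {n : ℕ} (t : Triple n n n) : Triple n n n :=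
  (min t.1 (min t.2.1 t.2.2), max (min t.1 t.2.1) (min (max t.1 t.2.1) t.2.2),
    max t.1 (max t.2.1 t.2.2))

lemma sortTriple_mem_sortedTriples {n : ℕ} (t : Triple n n n) : sortTriple t ∈ sortedTriples n := by
  obtain ⟨i, j, k⟩ := t
  simp only [sortTriple, sortedTriples, Set.mem_ofPred_eq]
  constructor <;> grind

lemma sortTriple_of_mem {n : ℕ} {i j k : Fin n} (h : (i, j, k) ∈ sortedTriples n) :
    sortTriple (i, j, k) = (i, j, k) := by
  simp only [sortedTriples, Set.mem_ofPred_eq] at h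
  simp only [sortTriple, Prod.mk.injEq]
  refine ⟨?_, ?_, ?_⟩ <;> grind

lemma sortTriple_swap_left {n : ℕ} (i j k : Fin n) :
    sortTriple (j, i, k) = sortTriple (i, j, k) := by
  simp only [sortTriple, Prod.mk.injEq]
  refine ⟨?_, ?_, ?_⟩ <;> grind

lemma sortTriple_swap_right {n : ℕ} (i j k : Fin n) :
    sortTriple (i, k, j) = sortTriple (i, j, k) := by
  simp only [sortTriple, Prod.mk.injEq]
  refine ⟨?_, ?_, ?_⟩ <;> grind

lemma sortTriple_eq_perm {n : ℕ} (i j k : Fin n) :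
    sortTriple (i, j, k) = (i, j, k) ∨ sortTriple (i, j, k) = (i, k, j) ∨
      sortTriple (i, j, k) = (j, i, k) ∨ sortTriple (i, j, k) = (j, k, i) ∨
      sortTriple (i, j, k) = (k, i, j) ∨ sortTriple (i, j, k) = (k, j, i) := by
  simp only [sortTriple, Prod.mk.injEq]
  rcases le_total i j with h₁ | h₁ <;> rcases le_total j k with h₂ | h₂ <;>
    rcases le_total i k with h₃ | h₃ <;> simp [h₁, h₂, h₃] <;> omega

lemma card_sortTriple_fiber_le {n : ℕ} (s : Triple n n n)
    [DecidablePred fun x : Triple n n n => sortTriple x = s] :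
    (Finset.univ.filter fun x : Triple n n n => sortTriple x = s).card ≤ 6 := by
  obtain ⟨a, b, c⟩ := s
  refine le_trans (Finset.card_le_card (t := {(a, b, c), (a, c, b), (b, a, c), (b, c, a), (c, a, b),
    (c, b, a)}) ?_) Finset.card_le_six
  rintro ⟨i, j, k⟩ h
  have h := (Finset.mem_filter.1 h).2
  have := sortTriple_eq_perm i j k
  rw [h] at this
  simp only [Prod.mk.injEq, Finset.mem_insert, Finset.mem_singleton] at this ⊢
  grind

/-- The symmetric sample is the preimage of a random set of sorted triples under sorting. -/
lemma mem_symmClosure_iff {n : ℕ} {B : Set (Triple n n n)} (hB : B ⊆ sortedTriples n)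
    (t : Triple n n n) : t ∈ symmClosure B ↔ sortTriple t ∈ B := by
  obtain ⟨i, j, k⟩ := t
  simp only [symmClosure, Set.mem_ofPred_eq]
  constructor
  · have key : ∀ {a b c : Fin n}, (a, b, c) ∈ B → sortTriple (a, b, c) ∈ B := fun h => by
      rwa [sortTriple_of_mem (hB h)]
    rintro (h | h | h | h | h | h) <;> have h := key h
    · exact h
    · rwa [sortTriple_swap_right] at h
    · rwa [sortTriple_swap_left] at h
    · rwa [sortTriple_swap_right, sortTriple_swap_left] at h
    · rwa [sortTriple_swap_left, sortTriple_swap_right] at h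
    · rwa [sortTriple_swap_left, sortTriple_swap_right, sortTriple_swap_left] at h
  · intro h
    rcases sortTriple_eq_perm i j k with e | e | e | e | e | e <;> rw [e] at h <;> simp [h]

/-! ### The two sampling models -/

theorem theorem2 :
    -- symmetric tensors, symmetric sampling
    (∃ C : ℝ, 0 < C ∧
      ∀ (n : ℕ), 1 ≤ n →
      ∀ (T : Tensor3 n n n), T.IsSymmetric →
      ∀ (α : ℝ) (p : unitInterval), Real.log n ≤ α → (p : ℝ) = α / (n : ℝ) ^ (3 / 2 : ℝ) →
        1 - 1 / (n : ℝ) ^ 5 ≤ (symmetricSample n p).real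
          {Ω | (T.proj Ω - (p : ℝ) • T).opNorm ≤
            C * T.maxEntry * (n : ℝ) ^ (3 / 2 : ℝ) * (p : ℝ) * (Real.log n) ^ 2 / √α}) ∧
    -- arbitrary tensors of dimensions `n₁ × n₂ × n₃`, independent sampling of all the entries
    (∀ κ : ℝ, ∃ C : ℝ, 0 < C ∧
      ∀ (n₁ n₂ n₃ n : ℕ), 1 ≤ n₁ → 1 ≤ n₂ → 1 ≤ n₃ → n = max n₁ (max n₂ n₃) →
      (n₁ : ℝ) ≤ κ * (n₂ * n₃) → (n₂ : ℝ) ≤ κ * (n₁ * n₃) → (n₃ : ℝ) ≤ κ * (n₁ * n₂) →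
      ∀ (T : Tensor3 n₁ n₂ n₃) (p : unitInterval),
        Real.log n ≤ (p : ℝ) * √((n₁ : ℝ) * n₂ * n₃) →
        1 - 1 / (n : ℝ) ^ 5 ≤ (independentSample n₁ n₂ n₃ p).real
          {Ω | (T.proj Ω - (p : ℝ) • T).triNorm ≤
            C * T.maxEntry * (Real.log n) ^ 2 * √(√((n₁ : ℝ) * n₂ * n₃) * (p : ℝ))}) := by
  refine ⟨⟨5760 * (1 + 1), by norm_num, ?_⟩, fun κ => ⟨5760 * (1 + |κ|), by positivity, ?_⟩⟩
  · intro n hn T _ α p hα hp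
    rcases hn.eq_or_lt with rfl | hn2
    · simp
    have hn1 : (1 : ℝ) ≤ n := by exact_mod_cast hn
    have hn0 : (0 : ℝ) < n := by linarith
    have hsqrt : √((n : ℝ) * n * n) = (n : ℝ) ^ (3 / 2 : ℝ) := by
      rw [Real.sqrt_eq_rpow, ← sq, ← pow_succ, ← Real.rpow_natCast, ← Real.rpow_mul hn0.le]
      norm_num
    have hpow : (0 : ℝ) < (n : ℝ) ^ (3 / 2 : ℝ) := Real.rpow_pos_of_pos hn0 _
    have hα' : (n : ℝ) ^ (3 / 2 : ℝ) * p = α := by rw [hp]; field_simp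
    have hd : (n : ℝ) ^ 2 ≤ 1 * (n * n * n) := by nlinarith [mul_pos hn0 hn0]
    classical
    have h := form_deviation hn2 le_rfl le_rfl le_rfl p (u := sortedTriples n) (q := sortTriple)
      sortTriple_mem_sortedTriples (fun s => by convert card_sortTriple_fiber_le s) one_pos hd hd hd
      (by rw [hsqrt, mul_comm, hα']; exact hα) T
    refine h.trans ?_
    rw [symmetricSample, map_measureReal_apply (measurable_of_finite _) (Set.toFinite _).measurableSet]
    refine ENNReal.toReal_mono (measure_ne_top _ _) (measure_mono_ae ?_)
    filter_upwards [setBernoulli_ae_subset] with B hB hgood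
    refine Real.iSup_le (fun v => ?_) ?_
    · have hv : ‖(v : EuclideanSpace ℝ (Fin n))‖ = 1 := by simp
      refine (hgood _ (mem_symmClosure_iff hB) v v v hv hv hv).trans (le_of_eq ?_)
      have e : 5760 * (1 + 1) * T.maxEntry * (n : ℝ) ^ (3 / 2 : ℝ) * p * Real.log n ^ 2 / √α =
          5760 * (1 + 1) * T.maxEntry * Real.log n ^ 2 * ((n : ℝ) ^ (3 / 2 : ℝ) * p / √α) := by
        ring
      rw [e, hsqrt, hα', Real.div_sqrt]
    · have := T.maxEntry_nonneg
      have := p.2.1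
      positivity
  · intro n₁ n₂ n₃ n h₁ h₂ h₃ hn hκ₁ hκ₂ hκ₃ T p hpL
    have p₁ : (1 : ℝ) ≤ n₁ := by exact_mod_cast h₁
    have p₂ : (1 : ℝ) ≤ n₂ := by exact_mod_cast h₂
    have p₃ : (1 : ℝ) ≤ n₃ := by exact_mod_cast h₃
    have hκ : 0 < κ := by
      by_contra hneg
      have : κ * ((n₂ : ℝ) * n₃) ≤ 0 := mul_nonpos_of_nonpos_of_nonneg (not_lt.1 hneg) (by positivity)
      linarith
    rw [abs_of_pos hκ]
    rcases (show 1 ≤ n by omega).eq_or_lt with rfl | hn2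
    · simp
    have hd₁ : (n₁ : ℝ) ^ 2 ≤ κ * (n₁ * n₂ * n₃) := by nlinarith
    have hd₂ : (n₂ : ℝ) ^ 2 ≤ κ * (n₁ * n₂ * n₃) := by nlinarith
    have hd₃ : (n₃ : ℝ) ^ 2 ≤ κ * (n₁ * n₂ * n₃) := by nlinarith
    classical
    have h := form_deviation (n := n) hn2 (by omega) (by omega) (by omega) p
      (u := (Set.univ : Set (Triple n₁ n₂ n₃))) (q := id) (fun _ => Set.mem_univ _)
      (fun s => by simp [Finset.filter_eq']) hκ hd₁ hd₂ hd₃ hpL T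
    refine h.trans ?_
    refine measureReal_mono fun ω hgood => ?_
    refine Real.iSup_le (fun v => ?_) ?_
    · exact hgood ω (fun _ => Iff.rfl) _ _ _ (by simp) (by simp)
        (by simp)
    · have := T.maxEntry_nonneg
      have := p.2.1
      positivity
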